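/- Let $N\ge 1$ be an integer, $\mathbb R_+=[0,\infty)$ and $\mathbb R_+^*=(0,\infty)$. For $L=(L_1,\dots,L_N)\in(\mathbb R_+^*)^N$ and $M=(m_{ij}):\mathbb R\to\mathcal M_N(\mathbb C)$, a solution of the transport system $\Sigma_\tau(L,M)$ $$\partial_t u_i+\partial_x u_i=0 \ \text{ on } \mathbb R_+\times[0,L_i],\qquad u_i(t,0)=\sum_{j=1}^N m_{ij}(t)\,u_j(t,L_j),\quad t\ge 0,\ 1\le i\le N,$$ with initial condition $u_0=(u_{i,0})_{1\le i\le N}$ is a family of functions $u_i:\mathbb R_+\times[0,L_i]\to\mathbb C$ that satisfies the second equation for every $t\ge0$, is constant along characteristics, i.e. $u_i(t+s,x+s)=u_i(t,x)$ for all $t\ge 0$, $x\in[0,L_i]$ and $s\in[-\min(x,t),L_i-x]$, and satisfies $u_i(0,x)=u_{i,0}(x)$ for all $x\in(0,L_i]$ (the value $u_i(0,0)$ is given by the second equation). For $p\in[1,+\infty]$ let $\mathsf X_p=\prod_{i=1}^N L^p([0,L_i],\mathbb C)$, with norm $\|u\|_p=\big(\sum_i\|u_i\|_{L^p}^p\big)^{1/p}$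 for $p<\infty$ and $\|u\|_\infty=\max_i\|u_i\|_{L^\infty}$. For $r\in\mathbb N$ and $R=(\rho_{kj})\in\mathcal M_{r,N}(\mathbb C)$ let $$\mathsf Y_p(R)=\Big\{u\in\mathsf X_p : \sum_{j=1}^N\rho_{kj}\int_0^{L_j}u_j(x)\,dx=0\ \text{ for } 1\le k\le r\Big\}.$$ For a set $\mathcal M$ of functions $M:\mathbb R\to\mathcal M_N(\mathbb C)$, $\Sigma_\tau(L,\mathcal M)$ denotes the family of the systems $\Sigma_\tau(L,M)$ with $M\in\mathcal M$. A matrix $R\in\mathcal M_{r,N}(\mathbb C)$, $r\in\mathbb N$, is in $\mathrm{Inv}(\mathcal M)$ (for the lengths $L$) if, for all $M\in\mathcal M$ and $p\in[1,+\infty]$, the solution $u$ of $\Sigma_\tau(L,M)$ with any initial condition $u_0\in\mathsf Y_p(R)$ satisfies $u(t)\in\mathsf Y_p(R)$ for all $t\ge0$. For $R\in\mathrm{Inv}(\mathcal M)$, $\Sigma_\tau(L,\mathcal M)$ is exponentially stable in $\mathsf Y_p(R)$ if there is $\gamma<0$ such that for every $\varepsilon>0$ there is $K>0$ such that, for all $M\in\mathcal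 M$, $u_0\in\mathsf Y_p(R)$ and $t\ge 0$, the solution $u$ of $\Sigma_\tau(L,M)$ with initial condition $u_0$ satisfies $\|u(t)\|_p\le Ke^{(\gamma+\varepsilon)t}\|u_0\|_p$. Let $\Lambda\in(\mathbb R_+^*)^N$ and let $V_+(\Lambda)$ be the set of all $L\in(\mathbb R_+^*)^N$ such that, for every $\mathbf n\in\mathbb Z^N$, $\Lambda\cdot\mathbf n=0$ implies $L\cdot\mathbf n=0$. Let $\mathfrak B$ be a nonempty bounded subset of $\mathcal M_N(\mathbb C)$ and $\mathcal M=L^\infty(\mathbb R,\mathfrak B)$, the set of measurable functions $M:\mathbb R\to\mathcal M_N(\mathbb C)$ with $M(t)\in\mathfrak B$ for almost every $t$. Then the following statements are equivalent. (i) $\Sigma_\tau(\Lambda,\mathcal M)$ is exponentially stable in $\mathsf Y_p(R)$ for some $p\in[1,+\infty]$ and some $R\in\mathrm{Inv}(\mathcal M)$, for the lengths $\Lambda$. (ii) $\Sigma_\tau(L,\mathcal M)$ is exponentially stable in $\mathsf Y_p(R)$ for every $L\in V_+(\Lambda)$, every $p\in[1,+\infty]$, and every $R\in\mathrm{Inv}(\mathcal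 M)$, for the lengths $L$. -/

import Mathlib

open MeasureTheory
open scoped ENNReal

namespace TransportSystem

/-- The set `V_+(Λ)`: vectors `L` with positive components that satisfy every integer linear
relation satisfied by `Λ`, i.e. `Z(Λ) ⊆ Z(L)` with `Z(Λ) = {n ∈ ℤ^N | Λ · n = 0}`. -/
def VPlus {N : ℕ} (Λ : Fin N → ℝ) : Set (Fin N → ℝ) :=
  {L | (∀ i, 0 < L i) ∧
    ∀ n : Fin N → ℤ, ∑ i, Λ i * (n i : ℝ) = 0 → ∑ i, L i * (n i : ℝ) = 0}

/-- Boundedness of a set of matrices (all norms on matrices being equivalent, it is expressed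
through the coefficients). -/
def BoundedMatrices {N : ℕ} (𝔅 : Set (Matrix (Fin N) (Fin N) ℂ)) : Prop :=
  ∃ C : ℝ, ∀ B ∈ 𝔅, ∀ i j, ‖B i j‖ ≤ C

/-- `L^∞(ℝ, 𝔅)`: the essentially bounded measurable functions with values in `𝔅` almost
everywhere (representatives are used, and every representative is allowed). -/
def LInfty {N : ℕ} (𝔅 : Set (Matrix (Fin N) (Fin N) ℂ)) :
    Set (ℝ → Matrix (Fin N) (Fin N) ℂ) :=
  {M | (∀ i j, MemLp (fun t => M t i j) ∞ (volume : Measure ℝ)) ∧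
    ∀ᵐ t ∂(volume : Measure ℝ), M t ∈ 𝔅}

/-- `u` is a solution of the transport system with lengths `L`, transmission matrix `M` and
initial condition `u₀`: each `u i` is constant along the characteristics in
`[0, ∞) × [0, L i]`, the transmission condition holds at every time `t ≥ 0`, and `u(0, ·) = u₀`.
At the corner `t = 0`, `x = 0` the value of `u i` is prescribed by the transmission condition,
so that the initial condition is imposed on `(0, L i]`. Only the values of `u i` on
`[0, ∞) × [0, L i]` and those of `u₀ i` on `(0, L i]` play a role. -/
structure IsSolution {N : ℕ} (L : Fin N → ℝ) (M : ℝ → Matrix (Fin N) (Fin N) ℂ)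
    (u₀ : Fin N → ℝ → ℂ) (u : Fin N → ℝ → ℝ → ℂ) : Prop where
  transmission : ∀ i, ∀ t : ℝ, 0 ≤ t → u i t 0 = ∑ j, M t i j * u j t (L j)
  transport : ∀ i, ∀ t : ℝ, 0 ≤ t → ∀ x ∈ Set.Icc 0 (L i),
    ∀ s ∈ Set.Icc (-(min x t)) (L i - x), u i (t + s) (x + s) = u i t x
  initial : ∀ i, ∀ x ∈ Set.Ioc 0 (L i), u i 0 x = u₀ i x

/-- Membership in `X_p = ∏ i, L^p([0, L i], ℂ)`, for representatives. -/
def MemX {N : ℕ} (L : Fin N → ℝ) (p : ℝ≥0∞) (f : Fin N → ℝ → ℂ) : Prop :=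
  ∀ i, MemLp (f i) p (volume.restrict (Set.Icc 0 (L i)))

/-- The norm of `X_p`, as an extended nonnegative real number. -/
noncomputable def normX {N : ℕ} (L : Fin N → ℝ) (p : ℝ≥0∞) (f : Fin N → ℝ → ℂ) : ℝ≥0∞ :=
  if p = ∞ then ⨆ i, eLpNorm (f i) ∞ (volume.restrict (Set.Icc 0 (L i)))
  else (∑ i, eLpNorm (f i) p (volume.restrict (Set.Icc 0 (L i))) ^ p.toReal) ^ (1 / p.toReal)

/-- Membership in `Y_p(R)`: the elements `f` of `X_p` with
`∑ j, R k j * ∫ x in [0, L j], f j x = 0` for every row `k` of `R`. -/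
def MemY {N r : ℕ} (L : Fin N → ℝ) (p : ℝ≥0∞) (R : Matrix (Fin r) (Fin N) ℂ)
    (f : Fin N → ℝ → ℂ) : Prop :=
  MemX L p f ∧ ∀ k, ∑ j, R k j * ∫ x in Set.Icc 0 (L j), f j x = 0

/-- `R ∈ Inv(𝓜)` for the lengths `L`: for every `p ∈ [1, ∞]` and `M ∈ 𝓜`, the space `Y_p(R)` is
invariant under the flow of the transport system. -/
def Inv {N r : ℕ} (L : Fin N → ℝ) (𝓜 : Set (ℝ → Matrix (Fin N) (Fin N) ℂ))
    (R : Matrix (Fin r) (Fin N) ℂ) : Prop :=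
  ∀ M ∈ 𝓜, ∀ p : ℝ≥0∞, 1 ≤ p → ∀ (u₀ : Fin N → ℝ → ℂ) (u : Fin N → ℝ → ℝ → ℂ),
    MemY L p R u₀ → IsSolution L M u₀ u → ∀ t : ℝ, 0 ≤ t → MemY L p R (fun i => u i t)

/-- The family of systems with `M ∈ 𝓜` is of exponential type `γ` in `Y_p(R)`. -/
def ExponentialType {N r : ℕ} (L : Fin N → ℝ) (𝓜 : Set (ℝ → Matrix (Fin N) (Fin N) ℂ))
    (p : ℝ≥0∞) (R : Matrix (Fin r) (Fin N) ℂ) (γ : ℝ) : Prop :=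
  ∀ ε : ℝ, 0 < ε → ∃ K : ℝ, 0 < K ∧
    ∀ M ∈ 𝓜, ∀ (u₀ : Fin N → ℝ → ℂ) (u : Fin N → ℝ → ℝ → ℂ),
      MemY L p R u₀ → IsSolution L M u₀ u → ∀ t : ℝ, 0 ≤ t →
        normX L p (fun i => u i t) ≤
          ENNReal.ofReal (K * Real.exp ((γ + ε) * t)) * normX L p u₀

/-- Exponential stability in `Y_p(R)`: negative exponential type. -/
def ExponentiallyStable {N r : ℕ} (L : Fin N → ℝ)
    (𝓜 : Set (ℝ → Matrix (Fin N) (Fin N) ℂ)) (p : ℝ≥0∞)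
    (R : Matrix (Fin r) (Fin N) ℂ) : Prop :=
  ∃ γ : ℝ, γ < 0 ∧ ExponentialType L 𝓜 p R γ

end TransportSystem

/-!
The boundary values `v i t = u i t 0` of a solution, continued to `[-L i, 0)` by
`w i t = u₀ i (-t)` and by `0` before, satisfy `v = w + A v` at all times, where
`(A f) i t = ∑ j, M t i j * f j (t - L j)`. Hence `v` is the sum of the functions `A ^ k w`, only
finitely many of which matter at a given time. Expanding the powers of `A` gives a sum over paths
of indices. A path that uses the index `j` a number `n j` of times carries the delay `L · n`.

If `L ∈ V_+(Λ)`, then `Λ · n` determines `L · n`, so that the paths can be grouped by the value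
`σ = Λ · n` (`IsSolution.trace_eq_sum_totalCoeff`). The coefficients `totalCoeff Λ B i σ j` depend
on `L` and on the signal `M` only through the values `B σ = M (t - L · n)`. The theorem follows
because stability is equivalent to the exponential decay of these coefficients in `σ`, uniformly
in `B` with values in `𝔅` (`CoeffDecay`), which does not mention `L`, `p` or `R`.

* `CoeffDecay.exponentiallyStable`: at time `t`, only delays `σ` at least proportional to `t`
  contribute, and their number is polynomial in `t`. The estimate in `X_p` follows from Minkowski's
  inequality for every `p`.
* `ExponentiallyStable.coeffDecay`: distinct delays `σ` are separated. A signal that is constant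
  near finitely many times takes prescribed values `B σ`, and an initial condition supported in a
  small interval makes a single coefficient visible. This initial condition can be chosen odd about
  the centre of the interval, hence of zero mean, so that it lies in `Y_p(R)` for every `R`.
-/

namespace TransportSystem

variable {N : ℕ}

/-! ### The delay equation satisfied by the boundary values -/

/-- The operator `(A f) i t = ∑ j, M t i j * f j (t - L j)` on families of functions of time. -/
def delayOp (L : Fin N → ℝ) (M : ℝ → Matrix (Fin N) (Fin N) ℂ) :
    Module.End ℂ (Fin N → ℝ → ℂ) where
  toFun f i t := ∑ j, M t i j * f j (t - L j)
  map_add' f g := by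
    funext i t
    simp [mul_add, Finset.sum_add_distrib]
  map_smul' a f := by
    funext i t
    simp only [Pi.smul_apply, smul_eq_mul, RingHom.id_apply, Finset.mul_sum]
    exact Finset.sum_congr rfl fun j _ => by ring

lemma delayOp_apply (L : Fin N → ℝ) (M : ℝ → Matrix (Fin N) (Fin N) ℂ)
    (f : Fin N → ℝ → ℂ) (i : Fin N) (t : ℝ) :
    delayOp L M f i t = ∑ j, M t i j * f j (t - L j) := rfl

/-- The initial condition read at the left end point: the value `u₀ i x` is carried by the
characteristic that passes through `x = 0` at the time `-x`, which lies in `[-L i, 0)`. Outside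
that interval the value is `0`. -/
noncomputable def initialTrace (L : Fin N → ℝ) (u₀ : Fin N → ℝ → ℂ) : Fin N → ℝ → ℂ :=
  fun i => (Set.Ico (-L i) 0).indicator fun t => u₀ i (-t)

/-- The values of a solution at the left end points, continued to negative times by
`initialTrace`. -/
noncomputable def trace (L : Fin N → ℝ) (u₀ : Fin N → ℝ → ℂ) (u : Fin N → ℝ → ℝ → ℂ) :
    Fin N → ℝ → ℂ :=
  fun i t => if 0 ≤ t then u i t 0 else initialTrace L u₀ i t

section Trace

variable {L : Fin N → ℝ} {M : ℝ → Matrix (Fin N) (Fin N) ℂ} {u₀ : Fin N → ℝ → ℂ}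
  {u : Fin N → ℝ → ℝ → ℂ}

lemma initialTrace_eq_zero_of_nonneg {i : Fin N} {t : ℝ} (ht : 0 ≤ t) :
    initialTrace L u₀ i t = 0 :=
  Set.indicator_of_notMem (fun h => absurd h.2 (not_lt.2 ht)) _

lemma initialTrace_eq_zero_of_lt {i : Fin N} {t : ℝ} (ht : t < -L i) :
    initialTrace L u₀ i t = 0 :=
  Set.indicator_of_notMem (fun h => absurd h.1 (not_le.2 ht)) _

lemma trace_eq_zero_of_lt (hL : ∀ i, 0 < L i) {i : Fin N} {t : ℝ} (ht : t < -L i) :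
    trace L u₀ u i t = 0 := by
  have := hL i
  rw [trace, if_neg (by linarith), initialTrace_eq_zero_of_lt ht]

lemma IsSolution.eq_trace (h : IsSolution L M u₀ u) {i : Fin N} {t x : ℝ} (ht : 0 ≤ t)
    (hx : x ∈ Set.Icc 0 (L i)) : u i t x = trace L u₀ u i (t - x) := by
  rcases le_or_gt x t with hxt | hxt
  · have := h.transport i t ht x hx (-x) ⟨by simp [min_eq_left hxt], by linarith [hx.1, hx.2]⟩
    rw [trace, if_pos (by linarith), ← this, sub_eq_add_neg, add_neg_cancel]
  · have := h.transport i t ht x hx (-t) ⟨by simp [min_eq_right hxt.le], by linarith [hx.1, hx.2]⟩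
    rw [trace, if_neg (by linarith), initialTrace, Set.indicator_of_mem
      (Set.mem_Ico.2 ⟨by linarith [hx.2], by linarith⟩), ← this, add_neg_cancel, h.initial i _
      ⟨by linarith, by linarith [hx.2]⟩]
    congr 1
    ring

lemma IsSolution.trace_eq_add (hL : ∀ i, 0 < L i) (h : IsSolution L M u₀ u) :
    trace L u₀ u = initialTrace L u₀ + delayOp L M (trace L u₀ u) := by
  funext i t
  rw [Pi.add_apply, Pi.add_apply, delayOp_apply]
  rcases le_or_gt 0 t with ht | ht
  · rw [initialTrace_eq_zero_of_nonneg ht, zero_add, trace, if_pos ht, h.transmission i t ht]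
    exact Finset.sum_congr rfl fun j _ => by rw [h.eq_trace ht ⟨(hL j).le, le_rfl⟩]
  · rw [Finset.sum_eq_zero fun j _ => by rw [trace_eq_zero_of_lt hL (by linarith), mul_zero],
      add_zero, trace, if_neg (not_le.2 ht)]

end Trace

lemma eq_sum_delayOp_pow {L : Fin N → ℝ} {M : ℝ → Matrix (Fin N) (Fin N) ℂ}
    {v w : Fin N → ℝ → ℂ} (h : v = w + delayOp L M v) (K : ℕ) :
    v = ∑ k ∈ Finset.range K, (delayOp L M ^ k) w + (delayOp L M ^ K) v := by
  induction K with
  | zero => simp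
  | succ K ih =>
    have h1 : (delayOp L M ^ K) v = (delayOp L M ^ K) w + (delayOp L M ^ (K + 1)) v := by
      rw [pow_succ, Module.End.mul_apply, ← map_add, ← h]
    rw [Finset.sum_range_succ, add_assoc, ← h1]
    exact ih

lemma delayOp_pow_eq_zero {L : Fin N → ℝ} {M : ℝ → Matrix (Fin N) (Fin N) ℂ} {m D : ℝ}
    (hm : ∀ j, m ≤ L j) {v : Fin N → ℝ → ℂ} (hv : ∀ j t, t < -D → v j t = 0) (K : ℕ) :
    ∀ i t, t < K * m - D → (delayOp L M ^ K) v i t = 0 := by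
  induction K with
  | zero => intro i t ht; exact hv i t (by simpa using ht)
  | succ K ih =>
    intro i t ht
    rw [pow_succ', Module.End.mul_apply, delayOp_apply]
    refine Finset.sum_eq_zero fun j _ => ?_
    push_cast at ht
    rw [ih j _ (by linarith [hm j]), mul_zero]

/-- At times `t < K * m - D` only the characteristics that were reflected fewer than `K` times
contribute to the solution. -/
lemma IsSolution.trace_eq_sum {L : Fin N → ℝ} {M : ℝ → Matrix (Fin N) (Fin N) ℂ}
    {u₀ : Fin N → ℝ → ℂ} {u : Fin N → ℝ → ℝ → ℂ} (hL : ∀ i, 0 < L i)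
    (h : IsSolution L M u₀ u) {m D : ℝ} (hm : ∀ j, m ≤ L j) (hD : ∀ j, L j ≤ D) {K : ℕ}
    {t : ℝ} (ht : t < K * m - D) (i : Fin N) :
    trace L u₀ u i t = ∑ k ∈ Finset.range K, (delayOp L M ^ k) (initialTrace L u₀) i t := by
  have h1 := congrFun (congrFun (eq_sum_delayOp_pow (h.trace_eq_add hL) K) i) t
  rw [Pi.add_apply, Pi.add_apply, delayOp_pow_eq_zero (D := D) hm
    (fun j t ht => trace_eq_zero_of_lt hL (by linarith [hD j])) K i t ht, add_zero] at h1
  rw [h1, Finset.sum_apply, Finset.sum_apply]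

/-! ### Existence of solutions -/

/-- The sum of the contributions of all characteristics. For positive lengths the sum is finite
at every time. -/
noncomputable def seriesTrace (L : Fin N → ℝ) (M : ℝ → Matrix (Fin N) (Fin N) ℂ)
    (u₀ : Fin N → ℝ → ℂ) : Fin N → ℝ → ℂ :=
  fun i t => ∑ᶠ k : ℕ, (delayOp L M ^ k) (initialTrace L u₀) i t

lemma exists_isSolution {L : Fin N → ℝ} (hL : ∀ i, 0 < L i) {m D : ℝ} (hm0 : 0 < m)
    (hm : ∀ j, m ≤ L j) (hD : ∀ j, L j ≤ D)
    (M : ℝ → Matrix (Fin N) (Fin N) ℂ) (u₀ : Fin N → ℝ → ℂ) :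
    ∃ u, IsSolution L M u₀ u := by
  have key : ∀ i t (K : ℕ), t < K * m - D → seriesTrace L M u₀ i t =
      ∑ k ∈ Finset.range K, (delayOp L M ^ k) (initialTrace L u₀) i t := by
    intro i t K hK
    refine finsum_eq_sum_of_support_subset _ fun k hk => ?_
    by_contra hkK
    have hkK : K ≤ k := by simpa using hkK
    refine hk (delayOp_pow_eq_zero (D := D) hm (fun j s hs =>
      initialTrace_eq_zero_of_lt (by linarith [hD j])) k i t (hK.trans_le ?_))
    have : (K : ℝ) ≤ k := by exact_mod_cast hkK
    nlinarith
  refine ⟨fun i t x => seriesTrace L M u₀ i (t - x), ?_, ?_, ?_⟩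
  · intro i t ht
    obtain ⟨K, hK⟩ := exists_nat_gt ((t + D) / m)
    rw [div_lt_iff₀ hm0] at hK
    rw [sub_zero, key i t (K + 1) (by push_cast; linarith), Finset.sum_range_succ', pow_zero,
      Module.End.one_apply, initialTrace_eq_zero_of_nonneg ht, add_zero]
    simp_rw [pow_succ', Module.End.mul_apply, delayOp_apply]
    rw [Finset.sum_comm]
    refine Finset.sum_congr rfl fun j _ => ?_
    rw [← Finset.mul_sum, key j (t - L j) K (by linarith [hL j])]
  · intro i t _ x _ s _
    simp
  · intro i x hx
    have h0 : (0 : ℝ) - x < -0 := by linarith [hx.1]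
    obtain ⟨K, hK⟩ := exists_nat_gt ((0 - x + D) / m)
    rw [div_lt_iff₀ hm0] at hK
    rw [key i (0 - x) (K + 1) (by push_cast; linarith), Finset.sum_range_succ', pow_zero,
      Module.End.one_apply, Finset.sum_eq_zero, zero_add, initialTrace, Set.indicator_of_mem
      (Set.mem_Ico.2 ⟨by linarith [hx.2], by linarith⟩)]
    · simp
    · intro k _
      rw [pow_succ', Module.End.mul_apply, delayOp_apply]
      refine Finset.sum_eq_zero fun j _ => ?_
      have hz : ∀ k : ℕ, ∀ i t, t < -L i → (delayOp L M ^ k) (initialTrace L u₀) i t = 0 := by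
        intro k
        induction k with
        | zero => intro i t ht; exact initialTrace_eq_zero_of_lt ht
        | succ k ih =>
          intro i t ht
          rw [pow_succ', Module.End.mul_apply, delayOp_apply]
          exact Finset.sum_eq_zero fun j _ => by
            rw [ih j _ (by linarith [hL i]), mul_zero]
      rw [hz k j _ (by linarith [hx.1]), mul_zero]

/-! ### Coefficients of the explicit solution formula -/

/-- `coeff Λ B i k σ j` is the sum over all sequences `i = j₀, j₁, …, j_k = j` with
`Λ j₁ + ⋯ + Λ j_k = σ` of the products of the entries
`B (Λ j₁ + ⋯ + Λ j_l) j_l j_{l+1}`, `0 ≤ l < k`. It is defined by removing the last step. -/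
noncomputable def coeff (Λ : Fin N → ℝ) (B : ℝ → Matrix (Fin N) (Fin N) ℂ) (i : Fin N) :
    ℕ → ℝ → Fin N → ℂ
  | 0, σ, j => if σ = 0 ∧ j = i then 1 else 0
  | k + 1, σ, j => ∑ j', coeff Λ B i k (σ - Λ j) j' * B (σ - Λ j) j' j

/-- The sum of `coeff Λ B i k σ j` over all numbers `k` of steps. For positive `Λ` it is a
finite sum. -/
noncomputable def totalCoeff (Λ : Fin N → ℝ) (B : ℝ → Matrix (Fin N) (Fin N) ℂ) (i : Fin N)
    (σ : ℝ) (j : Fin N) : ℂ :=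
  ∑ᶠ k : ℕ, coeff Λ B i k σ j

/-- The values `Λ · n` for `n ∈ ℕ^N` with entries at most `K`. -/
noncomputable def delays (Λ : Fin N → ℝ) (K : ℕ) : Finset ℝ :=
  (Fintype.piFinset fun _ : Fin N => Finset.range (K + 1)).image
    fun n => ∑ j, Λ j * (n j : ℝ)

lemma card_delays_le (Λ : Fin N → ℝ) (K : ℕ) : (delays Λ K).card ≤ (K + 1) ^ N := by
  refine Finset.card_image_le.trans ?_
  simp

lemma sum_mul_mem_delays (Λ : Fin N → ℝ) {K : ℕ} {n : Fin N → ℕ} (hn : ∑ j, n j ≤ K) :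
    ∑ j, Λ j * (n j : ℝ) ∈ delays Λ K := by
  refine Finset.mem_image.2 ⟨n, Fintype.mem_piFinset.2 fun j => ?_, rfl⟩
  have := Finset.single_le_sum (f := n) (fun _ _ => Nat.zero_le _) (Finset.mem_univ j)
  simp only [Finset.mem_range]
  omega

lemma exists_of_coeff_ne_zero {Λ : Fin N → ℝ} {B : ℝ → Matrix (Fin N) (Fin N) ℂ} {i : Fin N}
    {k : ℕ} : ∀ {σ : ℝ} {j : Fin N}, coeff Λ B i k σ j ≠ 0 →
      ∃ n : Fin N → ℕ, ∑ j, n j = k ∧ ∑ j, Λ j * (n j : ℝ) = σ := by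
  induction k with
  | zero =>
    intro σ j h
    rw [coeff] at h
    refine ⟨0, by simp, ?_⟩
    by_contra hσ
    exact h (if_neg fun h' => hσ (by simp [h'.1]))
  | succ k ih =>
    intro σ j h
    rw [coeff] at h
    obtain ⟨j', -, hj'⟩ := Finset.exists_ne_zero_of_sum_ne_zero h
    obtain ⟨n, hn1, hn2⟩ := ih (left_ne_zero_of_mul hj')
    refine ⟨n + Pi.single j 1, ?_, ?_⟩
    · simp [Finset.sum_add_distrib, hn1]
    · have h1 : ∑ x, Λ x * ((Pi.single j 1 : Fin N → ℕ) x : ℝ) = Λ j := by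
        rw [Finset.sum_eq_single j] <;> simp +contextual
      simp only [Pi.add_apply, Nat.cast_add, mul_add, Finset.sum_add_distrib, hn2, h1]
      ring

lemma mem_delays_of_coeff_ne_zero {Λ : Fin N → ℝ} {B : ℝ → Matrix (Fin N) (Fin N) ℂ}
    {i : Fin N} {k K : ℕ} (hk : k ≤ K) {σ : ℝ} {j : Fin N} (h : coeff Λ B i k σ j ≠ 0) :
    σ ∈ delays Λ K := by
  obtain ⟨n, hn, rfl⟩ := exists_of_coeff_ne_zero h
  exact sum_mul_mem_delays Λ (hn.trans_le hk)

/-- A vector `L` in `V_+(Λ)` defines a map `Λ · n ↦ L · n` on delays. -/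
lemma exists_delay_map {Λ L : Fin N → ℝ} (hL : L ∈ VPlus Λ) :
    ∃ φ : ℝ → ℝ, ∀ n : Fin N → ℕ, φ (∑ j, Λ j * (n j : ℝ)) = ∑ j, L j * (n j : ℝ) := by
  have hf : Function.FactorsThrough (fun n : Fin N → ℕ => ∑ j, L j * (n j : ℝ))
      (fun n : Fin N → ℕ => ∑ j, Λ j * (n j : ℝ)) := by
    intro n n' h
    have := hL.2 (fun j => (n j : ℤ) - n' j) (by
      push_cast
      simp only [mul_sub, Finset.sum_sub_distrib]
      exact sub_eq_zero.2 h)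
    push_cast at this
    simp only [mul_sub, Finset.sum_sub_distrib] at this
    exact sub_eq_zero.1 this
  exact ⟨Function.extend _ _ 0, fun n => hf.extend_apply _ n⟩

/-- Each application of the delay operator reflects every characteristic once. The path sums are
indexed by the delays for `Λ`, and `φ` converts them to delays for `L`. -/
lemma delayOp_pow_apply {Λ L : Fin N → ℝ} {φ : ℝ → ℝ}
    (hφ : ∀ n : Fin N → ℕ, φ (∑ j, Λ j * (n j : ℝ)) = ∑ j, L j * (n j : ℝ))
    {M B : ℝ → Matrix (Fin N) (Fin N) ℂ} {K : ℕ} {t : ℝ}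
    (hB : ∀ σ ∈ delays Λ K, B σ = M (t - φ σ)) (i : Fin N) (k : ℕ) :
    k ≤ K → ∀ f : Fin N → ℝ → ℂ, (delayOp L M ^ k) f i t =
      ∑ σ ∈ delays Λ K, ∑ j, coeff Λ B i k σ j * f j (t - φ σ) := by
  have hφ0 : φ 0 = 0 := by simpa using hφ 0
  induction k with
  | zero =>
    intro _ f
    have h0 : (0 : ℝ) ∈ delays Λ K := by
      simpa using sum_mul_mem_delays Λ (K := K) (n := 0) (by simp)
    rw [Finset.sum_eq_single_of_mem 0 h0, Finset.sum_eq_single i]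
    · simp [coeff, hφ0]
    · intro j _ hj
      simp [coeff, hj]
    · simp
    · intro σ _ hσ
      simp [coeff, hσ]
  | succ k ih =>
    intro hk f
    rw [pow_succ, Module.End.mul_apply, ih (by omega)]
    have h1 : ∀ σ ∈ delays Λ K,
        ∑ j', coeff Λ B i k σ j' * delayOp L M f j' (t - φ σ) =
        ∑ j, (∑ j', coeff Λ B i k σ j' * B σ j' j) * f j (t - φ σ - L j) := by
      intro σ hσ
      simp_rw [delayOp_apply, Finset.mul_sum, Finset.sum_mul, hB σ hσ]
      rw [Finset.sum_comm]
      simp_rw [mul_assoc]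
    rw [Finset.sum_congr rfl h1, Finset.sum_comm, Finset.sum_comm (s := delays Λ K)]
    refine Finset.sum_congr rfl fun j _ => ?_
    have hstep : ∀ σ, coeff Λ B i (k + 1) (σ + Λ j) j = ∑ j', coeff Λ B i k σ j' * B σ j' j := by
      intro σ
      rw [coeff, add_sub_cancel_right]
    have hshift : ∀ n : Fin N → ℕ,
        φ (∑ x, Λ x * (n x : ℝ) + Λ j) = φ (∑ x, Λ x * (n x : ℝ)) + L j := by
      intro n
      have h1 : ∀ Λ : Fin N → ℝ, ∑ x, Λ x * (((n + Pi.single j 1 : Fin N → ℕ) x : ℕ) : ℝ)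
          = ∑ x, Λ x * (n x : ℝ) + Λ j := by
        intro Λ
        have h2 : ∑ x, Λ x * ((Pi.single j 1 : Fin N → ℕ) x : ℝ) = Λ j := by
          rw [Finset.sum_eq_single j] <;> simp +contextual
        simp only [Pi.add_apply, Nat.cast_add, mul_add, Finset.sum_add_distrib, h2]
      rw [← h1, hφ, hφ, h1]
    have hterm : ∀ σ ∈ delays Λ K,
        (∑ j', coeff Λ B i k σ j' * B σ j' j) * f j (t - φ σ - L j) =
          coeff Λ B i (k + 1) (σ + Λ j) j * f j (t - φ (σ + Λ j)) := by
      intro σ hσ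
      obtain ⟨n, -, rfl⟩ := Finset.mem_image.1 hσ
      rw [hstep, hshift, sub_sub]
    refine Finset.sum_bij_ne_zero (fun σ _ _ => σ + Λ j) ?_ ?_ ?_ ?_
    · intro σ hσ hne
      rw [hterm σ hσ] at hne
      exact mem_delays_of_coeff_ne_zero hk (left_ne_zero_of_mul hne)
    · intro σ _ _ σ' _ _ h
      exact add_right_cancel h
    · intro σ hσ hne
      have h0 := left_ne_zero_of_mul hne
      rw [coeff] at h0
      obtain ⟨j', -, hj'⟩ := Finset.exists_ne_zero_of_sum_ne_zero h0
      have hmem : σ - Λ j ∈ delays Λ K :=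
        mem_delays_of_coeff_ne_zero (by omega) (left_ne_zero_of_mul hj')
      refine ⟨σ - Λ j, hmem, ?_, sub_add_cancel _ _⟩
      rw [hterm _ hmem, sub_add_cancel]
      exact hne
    · intro σ hσ _
      exact hterm σ hσ

/-- The explicit solution formula. -/
lemma IsSolution.trace_eq_sum_totalCoeff {Λ L : Fin N → ℝ} {φ : ℝ → ℝ}
    (hφ : ∀ n : Fin N → ℕ, φ (∑ j, Λ j * (n j : ℝ)) = ∑ j, L j * (n j : ℝ))
    {M B : ℝ → Matrix (Fin N) (Fin N) ℂ} {u₀ : Fin N → ℝ → ℂ} {u : Fin N → ℝ → ℝ → ℂ}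
    (h : IsSolution L M u₀ u) {m D : ℝ} (hm0 : 0 < m) (hm : ∀ j, m ≤ L j) (hD : ∀ j, L j ≤ D)
    {K : ℕ} {t : ℝ} (ht : t < K * m - D)
    (hB : ∀ σ ∈ delays Λ K, B σ = M (t - φ σ)) (i : Fin N) :
    trace L u₀ u i t =
      ∑ σ ∈ delays Λ K, ∑ j, totalCoeff Λ B i σ j * initialTrace L u₀ j (t - φ σ) := by
  rw [h.trace_eq_sum (fun j => hm0.trans_le (hm j)) hm hD ht, Finset.sum_congr rfl fun k hk =>
    delayOp_pow_apply hφ hB i k (Finset.mem_range.1 hk).le _, Finset.sum_comm]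
  refine Finset.sum_congr rfl fun σ _ => ?_
  rw [Finset.sum_comm]
  refine Finset.sum_congr rfl fun j _ => ?_
  rw [← Finset.sum_mul]
  by_cases hw : initialTrace L u₀ j (t - φ σ) = 0
  · rw [hw, mul_zero, mul_zero]
  congr 1
  symm
  refine finsum_eq_sum_of_support_subset _ fun k hk => ?_
  -- A path with `k` steps has a delay at least `k * m`, and only delays at most `t + D` meet the
  -- support of the initial condition.
  obtain ⟨n, hn, rfl⟩ := exists_of_coeff_ne_zero hk
  rw [hφ] at hw
  have h1 : -L j ≤ t - ∑ j, L j * (n j : ℝ) := by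
    by_contra h1
    exact hw (initialTrace_eq_zero_of_lt (not_le.1 h1))
  have h2 : (k : ℝ) * m ≤ ∑ j, L j * (n j : ℝ) := by
    rw [← hn, Nat.cast_sum, Finset.sum_mul]
    refine Finset.sum_le_sum fun j _ => ?_
    rw [mul_comm]
    exact mul_le_mul_of_nonneg_right (hm j) (Nat.cast_nonneg _)
  have h3 : (k : ℝ) * m < K * m := by linarith [hD j]
  have h4 : (k : ℝ) < K := lt_of_mul_lt_mul_right h3 hm0.le
  simpa using h4

/-! ### Estimates in `X_p` -/

lemma eLpNorm_le_normX {L : Fin N → ℝ} {p : ℝ≥0∞} (hp : 1 ≤ p) (f : Fin N → ℝ → ℂ)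
    (i : Fin N) : eLpNorm (f i) p (volume.restrict (Set.Icc 0 (L i))) ≤ normX L p f := by
  rw [normX]
  split_ifs with h
  · subst h
    exact le_iSup (fun i => eLpNorm (f i) ∞ (volume.restrict (Set.Icc 0 (L i)))) i
  · have hp0 : 0 < p.toReal := ENNReal.toReal_pos (zero_lt_one.trans_le hp).ne' h
    rw [one_div, ENNReal.le_rpow_inv_iff hp0]
    exact Finset.single_le_sum
      (f := fun i => eLpNorm (f i) p (volume.restrict (Set.Icc 0 (L i))) ^ p.toReal)
      (fun _ _ => zero_le) (Finset.mem_univ i)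

lemma normX_le {L : Fin N → ℝ} {p : ℝ≥0∞} (hp : 1 ≤ p) {f : Fin N → ℝ → ℂ} {b : ℝ≥0∞}
    (hb : ∀ i, eLpNorm (f i) p (volume.restrict (Set.Icc 0 (L i))) ≤ b) :
    normX L p f ≤ N * b := by
  rw [normX]
  split_ifs with h
  · subst h
    refine iSup_le fun i => (hb i).trans ?_
    have : (1 : ℝ≥0∞) ≤ N := by exact_mod_cast i.pos
    simpa using mul_le_mul_left this b
  · have hp0 : 0 < p.toReal := ENNReal.toReal_pos (zero_lt_one.trans_le hp).ne' h
    have hp1 : 1 ≤ p.toReal := by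
      simpa using ENNReal.toReal_mono h hp
    rw [one_div, ENNReal.rpow_inv_le_iff hp0, ENNReal.mul_rpow_of_nonneg _ _ hp0.le]
    calc _ ≤ ∑ _i : Fin N, b ^ p.toReal :=
          Finset.sum_le_sum fun i _ => ENNReal.rpow_le_rpow (hb i) hp0.le
      _ = (N : ℝ≥0∞) * b ^ p.toReal := by simp
      _ ≤ _ := by
        gcongr
        rcases Nat.eq_zero_or_pos N with h0 | h0
        · simp [h0]
        · have : (1 : ℝ≥0∞) ≤ N := by exact_mod_cast h0
          simpa using ENNReal.rpow_le_rpow_of_exponent_le this hp1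

lemma initialTrace_eq_comp_neg (L : Fin N → ℝ) (u₀ : Fin N → ℝ → ℂ) (j : Fin N) :
    initialTrace L u₀ j = (Set.Ioc 0 (L j)).indicator (u₀ j) ∘ Neg.neg := by
  funext t
  simp only [initialTrace, Function.comp, Set.indicator_apply, Set.mem_Ico, Set.mem_Ioc]
  refine if_congr ⟨fun h => ⟨by linarith, by linarith⟩, fun h => ⟨by linarith, by linarith⟩⟩
    rfl rfl

lemma memLp_initialTrace {L : Fin N → ℝ} {p : ℝ≥0∞} {u₀ : Fin N → ℝ → ℂ} (h : MemX L p u₀)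
    (j : Fin N) : MemLp (initialTrace L u₀ j) p volume ∧
      eLpNorm (initialTrace L u₀ j) p volume ≤
        eLpNorm (u₀ j) p (volume.restrict (Set.Icc 0 (L j))) := by
  have h1 : MemLp ((Set.Ioc 0 (L j)).indicator (u₀ j)) p volume :=
    (memLp_indicator_iff_restrict measurableSet_Ioc).2
      ((h j).mono_measure (Measure.restrict_mono Set.Ioc_subset_Icc_self le_rfl))
  have h2 : MeasurePreserving (Neg.neg : ℝ → ℝ) volume volume :=
    Measure.measurePreserving_neg volume
  rw [initialTrace_eq_comp_neg]
  refine ⟨h1.comp_measurePreserving h2, ?_⟩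
  rw [eLpNorm_comp_measurePreserving h1.1 h2,
    eLpNorm_indicator_eq_eLpNorm_restrict measurableSet_Ioc]
  exact eLpNorm_mono_measure _ (Measure.restrict_mono Set.Ioc_subset_Icc_self le_rfl)

lemma memLp_delayOp {L : Fin N → ℝ} {M : ℝ → Matrix (Fin N) (Fin N) ℂ}
    (hM : ∀ i j, MemLp (fun t => M t i j) ∞ (volume : Measure ℝ)) {p : ℝ≥0∞}
    {f : Fin N → ℝ → ℂ} (hf : ∀ j, MemLp (f j) p volume) (i : Fin N) :
    MemLp (delayOp L M f i) p volume := by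
  have : delayOp L M f i = fun t => ∑ j, M t i j * f j (t - L j) := rfl
  rw [this]
  refine memLp_finsetSum _ fun j _ => ?_
  exact MemLp.mul (p := ∞) (q := p) (r := p)
    ((hf j).comp_measurePreserving (measurePreserving_sub_right volume (L j))) (hM i j)

/-- Well-posedness in `X_p`. -/
lemma IsSolution.memX {L : Fin N → ℝ} {M : ℝ → Matrix (Fin N) (Fin N) ℂ}
    {u₀ : Fin N → ℝ → ℂ} {u : Fin N → ℝ → ℝ → ℂ} (h : IsSolution L M u₀ u)
    {m D : ℝ} (hm0 : 0 < m) (hm : ∀ j, m ≤ L j) (hD : ∀ j, L j ≤ D)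
    (hM : ∀ i j, MemLp (fun t => M t i j) ∞ (volume : Measure ℝ)) {p : ℝ≥0∞}
    (hu₀ : MemX L p u₀) {t : ℝ} (ht : 0 ≤ t) : MemX L p fun i => u i t := by
  intro i
  obtain ⟨K, hK⟩ := exists_nat_gt ((t + D) / m)
  rw [div_lt_iff₀ hm0] at hK
  have hpow : ∀ k : ℕ, ∀ j, MemLp ((delayOp L M ^ k) (initialTrace L u₀) j) p volume := by
    intro k
    induction k with
    | zero => exact fun j => (memLp_initialTrace hu₀ j).1
    | succ k ih =>
      intro j
      rw [pow_succ', Module.End.mul_apply]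
      exact memLp_delayOp hM ih j
  have hsum : MemLp (fun x => ∑ k ∈ Finset.range K,
      (delayOp L M ^ k) (initialTrace L u₀) i (t - x)) p volume :=
    memLp_finsetSum _ fun k _ =>
      (hpow k i).comp_measurePreserving (Measure.measurePreserving_sub_left volume t)
  refine (hsum.mono_measure Measure.restrict_le_self).ae_eq ?_
  filter_upwards [ae_restrict_mem measurableSet_Icc] with x hx
  rw [h.eq_trace ht hx, h.trace_eq_sum (fun j => hm0.trans_le (hm j)) hm hD
    (by linarith [hx.1])]

/-! ### From the decay of the coefficients to exponential stability -/

/-- Uniform exponential decay, in the delay, of the coefficients of the explicit solution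
formula. The condition involves neither the exponent `p` nor the space `Y_p(R)`. -/
def CoeffDecay (Λ : Fin N → ℝ) (𝔅 : Set (Matrix (Fin N) (Fin N) ℂ)) : Prop :=
  ∃ C c : ℝ, 0 < C ∧ 0 < c ∧ ∀ B : ℝ → Matrix (Fin N) (Fin N) ℂ, (∀ σ, B σ ∈ 𝔅) →
    ∀ i σ j, ‖totalCoeff Λ B i σ j‖ ≤ C * Real.exp (-(c * σ))

lemma exists_pos_bounds {L : Fin N → ℝ} (hL : ∀ i, 0 < L i) :
    ∃ m D : ℝ, 0 < m ∧ 0 < D ∧ (∀ j, m ≤ L j) ∧ ∀ j, L j ≤ D := by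
  rcases isEmpty_or_nonempty (Fin N) with h | h
  · exact ⟨1, 1, one_pos, one_pos, fun j => h.elim j, fun j => h.elim j⟩
  obtain ⟨a, ha⟩ := Finite.exists_min L
  obtain ⟨b, hb⟩ := Finite.exists_max L
  exact ⟨L a, L b, hL a, hL b, ha, hb⟩

/-- A polynomial in `t` is dominated by an exponential of arbitrarily small rate. -/
lemma exists_pow_le_exp (N : ℕ) {δ : ℝ} (hδ : 0 < δ) {a q : ℝ} (ha : 0 ≤ a) (hq : 0 ≤ q) :
    ∃ P : ℝ, 0 < P ∧ ∀ t, 0 ≤ t → (a * t + q) ^ N ≤ P * Real.exp (δ * t) := by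
  set η : ℝ := δ / (N + 1) with hη
  have hη0 : 0 < η := by positivity
  refine ⟨(q + a / η + 1) ^ N, by positivity, fun t ht => ?_⟩
  have h1 : a * t + q ≤ (q + a / η + 1) * Real.exp (η * t) := by
    have h2 : 1 + η * t ≤ Real.exp (η * t) := by linarith [Real.add_one_le_exp (η * t)]
    have h3 : a / η * (η * t) = a * t := by field_simp
    have h4 : 0 ≤ a / η := by positivity
    have h5 : 0 ≤ η * t := by positivity
    calc a * t + q ≤ (q + a / η + 1) * (1 + η * t) := by nlinarith
      _ ≤ _ := by gcongr
  calc (a * t + q) ^ N ≤ ((q + a / η + 1) * Real.exp (η * t)) ^ N := by gcongr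
    _ = (q + a / η + 1) ^ N * Real.exp (N * (η * t)) := by rw [mul_pow, Real.exp_nat_mul]
    _ ≤ _ := by
      have h2 : (N : ℝ) * η ≤ δ := by
        rw [hη, mul_div_assoc', div_le_iff₀ (by positivity)]
        linarith
      rw [← mul_assoc]
      gcongr

section Stability

variable {Λ L : Fin N → ℝ} {φ : ℝ → ℝ} {𝔅 : Set (Matrix (Fin N) (Fin N) ℂ)} {C c m D : ℝ}
  {M : ℝ → Matrix (Fin N) (Fin N) ℂ} {u₀ : Fin N → ℝ → ℂ} {u : Fin N → ℝ → ℝ → ℂ}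

/-- The delays for `Λ` and for `L` of the same path are comparable, so that the coefficients that
contribute at times near `t` are exponentially small. -/
lemma IsSolution.ae_norm_trace_le
    (hφ : ∀ n : Fin N → ℕ, φ (∑ j, Λ j * (n j : ℝ)) = ∑ j, L j * (n j : ℝ))
    (h𝔅 : 𝔅.Nonempty) (hC : 0 < C) (hc : 0 < c)
    (hdec : ∀ B : ℝ → Matrix (Fin N) (Fin N) ℂ, (∀ σ, B σ ∈ 𝔅) →
      ∀ i σ j, ‖totalCoeff Λ B i σ j‖ ≤ C * Real.exp (-(c * σ)))
    (hm0 : 0 < m) (hD0 : 0 < D) (hm : ∀ j, m ≤ L j) (hmΛ : ∀ j, m ≤ Λ j) (hD : ∀ j, L j ≤ D)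
    (hM : M ∈ LInfty 𝔅) (h : IsSolution L M u₀ u) {K : ℕ} {t : ℝ} (ht : t + D < K * m)
    (i : Fin N) :
    ∀ᵐ s ∂(volume : Measure ℝ), s ∈ Set.Icc (t - D) t → ‖trace L u₀ u i s‖ ≤
      C * Real.exp (-(c * (m / D * (t - D)))) *
        ∑ σ ∈ delays Λ K, ∑ j, ‖initialTrace L u₀ j (s - φ σ)‖ := by
  classical
  obtain ⟨b, hb⟩ := h𝔅
  have hae : ∀ᵐ s ∂(volume : Measure ℝ), ∀ σ ∈ delays Λ K, M (s - φ σ) ∈ 𝔅 :=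
    (Finset.eventually_all _).2 fun σ _ =>
      (measurePreserving_sub_right volume (φ σ)).quasiMeasurePreserving.ae hM.2
  filter_upwards [hae] with s hs hst
  have hB : ∀ σ ∈ delays Λ K,
      (fun σ => if M (s - φ σ) ∈ 𝔅 then M (s - φ σ) else b) σ = M (s - φ σ) :=
    fun σ hσ => if_pos (hs σ hσ)
  rw [h.trace_eq_sum_totalCoeff hφ hm0 hm hD (K := K) (by linarith [hst.2]) hB i, Finset.mul_sum]
  refine (norm_sum_le _ _).trans (Finset.sum_le_sum fun σ hσ => ?_)
  rw [Finset.mul_sum]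
  refine (norm_sum_le _ _).trans (Finset.sum_le_sum fun j _ => ?_)
  rw [norm_mul]
  by_cases hw : initialTrace L u₀ j (s - φ σ) = 0
  · rw [hw, norm_zero, mul_zero, mul_zero]
  refine mul_le_mul_of_nonneg_right ?_ (norm_nonneg _)
  refine (hdec _ (fun σ => ?_) i σ j).trans ?_
  · split_ifs with h'
    exacts [h', hb]
  · gcongr
    have h1 : s - φ σ < 0 := by
      by_contra h1
      exact hw (initialTrace_eq_zero_of_nonneg (not_lt.1 h1))
    obtain ⟨n, -, rfl⟩ := Finset.mem_image.1 hσ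
    rw [hφ] at h1
    calc m / D * (t - D) ≤ m / D * ∑ j, L j * (n j : ℝ) := by
          gcongr
          linarith [hst.1]
      _ = ∑ j, m * (L j / D) * (n j : ℝ) := by
          rw [Finset.mul_sum]
          exact Finset.sum_congr rfl fun j _ => by ring
      _ ≤ ∑ j, Λ j * (n j : ℝ) := by
          gcongr with j
          have h2 : L j / D ≤ 1 := (div_le_one hD0).2 (hD j)
          nlinarith [hmΛ j]

lemma IsSolution.normX_le
    (hφ : ∀ n : Fin N → ℕ, φ (∑ j, Λ j * (n j : ℝ)) = ∑ j, L j * (n j : ℝ))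
    (h𝔅 : 𝔅.Nonempty) (hC : 0 < C) (hc : 0 < c)
    (hdec : ∀ B : ℝ → Matrix (Fin N) (Fin N) ℂ, (∀ σ, B σ ∈ 𝔅) →
      ∀ i σ j, ‖totalCoeff Λ B i σ j‖ ≤ C * Real.exp (-(c * σ)))
    (hm0 : 0 < m) (hD0 : 0 < D) (hm : ∀ j, m ≤ L j) (hmΛ : ∀ j, m ≤ Λ j) (hD : ∀ j, L j ≤ D)
    (hM : M ∈ LInfty 𝔅) (h : IsSolution L M u₀ u) {p : ℝ≥0∞} (hp : 1 ≤ p)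
    (hu₀ : MemX L p u₀) {K : ℕ} {t : ℝ} (ht0 : 0 ≤ t) (ht : t + D < K * m) :
    normX L p (fun i => u i t) ≤ ENNReal.ofReal
      (N * (C * Real.exp (-(c * (m / D * (t - D)))) * (((K : ℝ) + 1) ^ N * N))) *
        normX L p u₀ := by
  set E := C * Real.exp (-(c * (m / D * (t - D)))) with hE
  have hE0 : 0 ≤ E := by positivity
  rw [ENNReal.ofReal_mul (Nat.cast_nonneg _), ENNReal.ofReal_natCast, mul_assoc]
  refine TransportSystem.normX_le hp fun i => ?_
  have hmp : ∀ σ, MeasurePreserving (fun x : ℝ => t - x - φ σ) volume volume := fun σ =>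
    (measurePreserving_sub_right volume (φ σ)).comp (Measure.measurePreserving_sub_left volume t)
  have hmeas : ∀ σ j, AEStronglyMeasurable
      (fun x => ‖initialTrace L u₀ j (t - x - φ σ)‖) volume := fun σ j =>
    ((memLp_initialTrace hu₀ j).1.1.comp_measurePreserving (hmp σ)).norm
  have hae : ∀ᵐ x ∂(volume.restrict (Set.Icc 0 (L i))), ‖u i t x‖ ≤
      ‖E * ∑ σ ∈ delays Λ K, ∑ j, ‖initialTrace L u₀ j (t - x - φ σ)‖‖ := by
    have h1 := (Measure.measurePreserving_sub_left volume t).quasiMeasurePreserving.ae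
      (h.ae_norm_trace_le hφ h𝔅 hC hc hdec hm0 hD0 hm hmΛ hD hM ht i)
    filter_upwards [ae_restrict_of_ae h1, ae_restrict_mem measurableSet_Icc] with x hx hxL
    rw [h.eq_trace ht0 hxL]
    refine (hx ⟨by linarith [hxL.2, hD i], by linarith [hxL.1]⟩).trans (le_abs_self _)
  calc eLpNorm (fun x => u i t x) p (volume.restrict (Set.Icc 0 (L i)))
      ≤ eLpNorm (fun x => E * ∑ σ ∈ delays Λ K, ∑ j, ‖initialTrace L u₀ j (t - x - φ σ)‖) p
          (volume.restrict (Set.Icc 0 (L i))) := eLpNorm_mono_ae hae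
    _ ≤ eLpNorm (fun x => E * ∑ σ ∈ delays Λ K, ∑ j, ‖initialTrace L u₀ j (t - x - φ σ)‖) p
          volume := eLpNorm_mono_measure _ Measure.restrict_le_self
    _ = ENNReal.ofReal E * eLpNorm (∑ σ ∈ delays Λ K, ∑ j,
          fun x => ‖initialTrace L u₀ j (t - x - φ σ)‖) p volume := by
        have : (fun x => E * ∑ σ ∈ delays Λ K, ∑ j, ‖initialTrace L u₀ j (t - x - φ σ)‖) =
            E • ∑ σ ∈ delays Λ K, ∑ j, fun x => ‖initialTrace L u₀ j (t - x - φ σ)‖ := by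
          funext x
          simp [Finset.sum_apply]
        rw [this, eLpNorm_const_smul, Real.enorm_eq_ofReal hE0]
    _ ≤ ENNReal.ofReal E * ∑ σ ∈ delays Λ K, ∑ j : Fin N, normX L p u₀ := by
        gcongr
        refine (eLpNorm_sum_le (fun σ _ =>
          Finset.aestronglyMeasurable_sum _ fun j _ => hmeas σ j) hp).trans ?_
        refine Finset.sum_le_sum fun σ _ => ?_
        refine (eLpNorm_sum_le (fun j _ => hmeas σ j) hp).trans ?_
        refine Finset.sum_le_sum fun j _ => ?_
        rw [eLpNorm_norm (fun x => initialTrace L u₀ j (t - x - φ σ))]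
        refine (eLpNorm_comp_measurePreserving (memLp_initialTrace hu₀ j).1.1 (hmp σ)).trans_le ?_
        exact (memLp_initialTrace hu₀ j).2.trans (eLpNorm_le_normX hp u₀ j)
    _ = ENNReal.ofReal E * ((delays Λ K).card * N) * normX L p u₀ := by
        simp only [Finset.sum_const, Finset.card_univ, Fintype.card_fin, nsmul_eq_mul]
        ring
    _ ≤ ENNReal.ofReal (E * (((K : ℝ) + 1) ^ N * N)) * normX L p u₀ := by
        rw [ENNReal.ofReal_mul hE0]
        gcongr
        have h1 : (((K : ℝ) + 1) ^ N * N) = (((K + 1) ^ N * N : ℕ) : ℝ) := by push_cast; ring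
        rw [h1, ENNReal.ofReal_natCast]
        exact_mod_cast Nat.mul_le_mul_right N (card_delays_le Λ K)

end Stability

theorem CoeffDecay.exponentiallyStable {Λ L : Fin N → ℝ} {𝔅 : Set (Matrix (Fin N) (Fin N) ℂ)}
    (hdec : CoeffDecay Λ 𝔅) (hΛ : ∀ i, 0 < Λ i) (h𝔅 : 𝔅.Nonempty) (hL : L ∈ VPlus Λ)
    {p : ℝ≥0∞} (hp : 1 ≤ p) {r : ℕ} (R : Matrix (Fin r) (Fin N) ℂ) :
    ExponentiallyStable L (LInfty 𝔅) p R := by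
  obtain ⟨C, c, hC, hc, hdec⟩ := hdec
  obtain ⟨φ, hφ⟩ := exists_delay_map hL
  obtain ⟨m₁, -, hm₁, -, hm₁Λ, -⟩ := exists_pos_bounds hΛ
  obtain ⟨m₂, D, hm₂, hD0, hm₂L, hD⟩ := exists_pos_bounds hL.1
  set m := min m₁ m₂ with hmdef
  have hm0 : 0 < m := lt_min hm₁ hm₂
  have hm : ∀ j, m ≤ L j := fun j => (min_le_right _ _).trans (hm₂L j)
  have hmΛ : ∀ j, m ≤ Λ j := fun j => (min_le_left _ _).trans (hm₁Λ j)
  set a := c * (m / D) with ha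
  have ha0 : 0 < a := by positivity
  obtain ⟨P, hP, hPt⟩ := exists_pow_le_exp N (δ := a / 2) (by positivity) (a := 1 / m)
    (q := D / m + 2) (by positivity) (by positivity)
  refine ⟨-(a / 2), by linarith, fun ε hε => ?_⟩
  refine ⟨N * N * C * Real.exp (a * D) * P + 1, by positivity, fun M hM u₀ u hu₀ h t ht => ?_⟩
  set K := ⌊(t + D) / m⌋₊ + 1 with hK
  have hK1 : t + D < K * m := by
    rw [← div_lt_iff₀ hm0, hK]
    push_cast
    exact Nat.lt_floor_add_one _
  have hK2 : (K : ℝ) + 1 ≤ 1 / m * t + (D / m + 2) := by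
    have := Nat.floor_le (a := (t + D) / m) (by positivity)
    rw [hK]
    push_cast
    have h2 : (t + D) / m = 1 / m * t + D / m := by ring
    linarith
  refine (h.normX_le hφ h𝔅 hC hc hdec hm0 hD0 hm hmΛ hD hM hp hu₀.1 ht hK1).trans ?_
  gcongr ENNReal.ofReal ?_ * _
  have h3 : ((K : ℝ) + 1) ^ N ≤ P * Real.exp (a / 2 * t) :=
    (pow_le_pow_left₀ (by positivity) hK2 N).trans (hPt t ht)
  have h4 : Real.exp (-(c * (m / D * (t - D)))) * Real.exp (a / 2 * t) =
      Real.exp (a * D) * Real.exp (-(a / 2) * t) := by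
    rw [← Real.exp_add, ← Real.exp_add]
    congr 1
    rw [ha]
    ring
  calc (N : ℝ) * (C * Real.exp (-(c * (m / D * (t - D)))) * (((K : ℝ) + 1) ^ N * N))
      ≤ N * (C * Real.exp (-(c * (m / D * (t - D)))) * (P * Real.exp (a / 2 * t) * N)) := by
        gcongr
    _ = N * N * C * P * (Real.exp (-(c * (m / D * (t - D)))) * Real.exp (a / 2 * t)) := by ring
    _ = N * N * C * Real.exp (a * D) * P * Real.exp (-(a / 2) * t) := by rw [h4]; ring
    _ ≤ (N * N * C * Real.exp (a * D) * P + 1) * Real.exp ((-(a / 2) + ε) * t) := by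
        gcongr
        · linarith
        · linarith

/-! ### From exponential stability to the decay of the coefficients -/

lemma totalCoeff_zero {Λ : Fin N → ℝ} (hΛ : ∀ i, 0 < Λ i)
    (B : ℝ → Matrix (Fin N) (Fin N) ℂ) (i j : Fin N) : ‖totalCoeff Λ B i 0 j‖ ≤ 1 := by
  have h : totalCoeff Λ B i 0 j = coeff Λ B i 0 0 j := by
    refine finsum_eq_single _ _ fun k hk => ?_
    by_contra hne
    obtain ⟨n, hn, h0⟩ := exists_of_coeff_ne_zero hne
    rw [Finset.sum_eq_zero_iff_of_nonneg fun j _ =>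
      mul_nonneg (hΛ j).le (Nat.cast_nonneg _)] at h0
    refine hk (hn ▸ Finset.sum_eq_zero fun j hj => ?_)
    simpa [(hΛ j).ne'] using h0 j hj
  rw [h, coeff]
  split_ifs <;> simp

lemma le_of_totalCoeff_ne_zero {Λ : Fin N → ℝ} (hΛ : ∀ i, 0 < Λ i)
    {B : ℝ → Matrix (Fin N) (Fin N) ℂ} {i j : Fin N} {σ : ℝ} (h : totalCoeff Λ B i σ j ≠ 0)
    (hσ : σ ≠ 0) : Λ j ≤ σ ∧ ∃ n : Fin N → ℕ, ∑ j, Λ j * (n j : ℝ) = σ := by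
  obtain ⟨k, hk⟩ : ∃ k, coeff Λ B i k σ j ≠ 0 := by
    by_contra! hk
    exact h (finsum_eq_zero_of_forall_eq_zero hk)
  refine ⟨?_, (exists_of_coeff_ne_zero hk).imp fun _ h => h.2⟩
  cases k with
  | zero => exact absurd (if_neg fun h => hσ h.1) hk
  | succ k =>
    rw [coeff] at hk
    obtain ⟨j', -, hj'⟩ := Finset.exists_ne_zero_of_sum_ne_zero hk
    obtain ⟨n, -, hn⟩ := exists_of_coeff_ne_zero (left_ne_zero_of_mul hj')
    have : 0 ≤ ∑ j, Λ j * (n j : ℝ) :=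
      Finset.sum_nonneg fun j _ => mul_nonneg (hΛ j).le (Nat.cast_nonneg _)
    linarith

/-- An odd function of modulus `1` almost everywhere on `(-δ, δ)` that vanishes elsewhere. -/
noncomputable def oddBump (δ : ℝ) : ℝ → ℂ :=
  fun x => (Set.Ioo 0 δ).indicator 1 x - (Set.Ioo (-δ) 0).indicator 1 x

lemma oddBump_eq_zero {δ x : ℝ} (hx : δ ≤ |x|) : oddBump δ x = 0 := by
  rw [oddBump, Set.indicator_of_notMem, Set.indicator_of_notMem, sub_zero]
  · rintro ⟨h1, h2⟩
    rw [abs_of_neg h2] at hx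
    linarith
  · rintro ⟨h1, h2⟩
    rw [abs_of_pos h1] at hx
    linarith

lemma norm_oddBump {δ x : ℝ} (hx : |x| < δ) (h0 : x ≠ 0) : ‖oddBump δ x‖ = 1 := by
  rw [abs_lt] at hx
  rcases h0.lt_or_gt with h | h
  · simp [oddBump, h, h.le, hx.1]
  · simp [oddBump, h, h.le, hx.2]

lemma measurable_oddBump (δ : ℝ) : Measurable (oddBump δ) :=
  (measurable_one.indicator measurableSet_Ioo).sub (measurable_one.indicator measurableSet_Ioo)

lemma norm_oddBump_le (δ x : ℝ) : ‖oddBump δ x‖ ≤ (Set.Ioo (-δ) δ).indicator (fun _ => 1) x := by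
  by_cases hx : |x| < δ
  · rw [Set.indicator_of_mem (Set.mem_Ioo.2 (abs_lt.1 hx))]
    rcases eq_or_ne x 0 with rfl | h0
    · simp [oddBump]
    · exact (norm_oddBump hx h0).le
  · rw [oddBump_eq_zero (not_lt.1 hx), norm_zero]
    exact Set.indicator_nonneg (fun _ _ => zero_le_one) _

lemma integral_oddBump {δ : ℝ} : ∫ x, oddBump δ x = 0 := by
  have h : ∀ x, oddBump δ (-x) = -oddBump δ x := by
    intro x
    have h1 : -x ∈ Set.Ioo 0 δ ↔ x ∈ Set.Ioo (-δ) 0 := by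
      simp only [Set.mem_Ioo]; constructor <;> rintro ⟨_, _⟩ <;> constructor <;> linarith
    have h2 : -x ∈ Set.Ioo (-δ) 0 ↔ x ∈ Set.Ioo 0 δ := by
      simp only [Set.mem_Ioo]; constructor <;> rintro ⟨_, _⟩ <;> constructor <;> linarith
    simp only [oddBump, Set.indicator_apply, h1, h2, Pi.one_apply, neg_sub]
  have h3 := integral_neg_eq_self (oddBump δ) volume
  simp_rw [h, integral_neg] at h3
  exact self_eq_neg.1 h3.symm

lemma eLpNorm_oddBump_le {p : ℝ≥0∞} {δ : ℝ} :
    eLpNorm (oddBump δ) p volume ≤ ENNReal.ofReal (2 * δ) ^ (1 / p.toReal) := by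
  have h1 := eLpNorm_mono (μ := volume) (p := p) (f := oddBump δ)
    (g := (Set.Ioo (-δ) δ).indicator fun _ => (1 : ℝ)) fun x =>
      (norm_oddBump_le δ x).trans (le_abs_self _)
  refine (h1.trans (eLpNorm_indicator_const_le _ _)).trans_eq ?_
  rw [enorm_one, one_mul, Real.volume_Ioo]
  congr 2
  ring

/-- Finitely many reals are separated by a positive distance. -/
lemma exists_separation (T : Finset ℝ) :
    ∃ δ : ℝ, 0 < δ ∧ ∀ x ∈ T, ∀ y ∈ T, |x - y| < 2 * δ → x = y := by
  classical
  obtain ⟨d, hd, h⟩ : ∃ d : ℝ, 0 < d ∧ ∀ z ∈ (T ×ˢ T).filter (fun z : ℝ × ℝ => z.1 ≠ z.2),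
      d ≤ |z.1 - z.2| := by
    rcases ((T ×ˢ T).filter (fun z : ℝ × ℝ => z.1 ≠ z.2)).eq_empty_or_nonempty with h | h
    · exact ⟨1, one_pos, by simp [h]⟩
    · obtain ⟨z, hz, hmin⟩ := Finset.exists_min_image _ (fun z : ℝ × ℝ => |z.1 - z.2|) h
      exact ⟨_, abs_pos.2 (sub_ne_zero.2 (Finset.mem_filter.1 hz).2), hmin⟩
  refine ⟨d / 2, by positivity, fun x hx y hy hxy => ?_⟩
  by_contra hne
  have := h (x, y) (by simp [hx, hy, hne])
  simp only at this
  linarith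

/-- The value `B σ` can be prescribed independently for each of the finitely many delays: a
piecewise constant signal takes these values near the times `t₀ - σ`. -/
lemma exists_signal {𝔅 : Set (Matrix (Fin N) (Fin N) ℂ)} (hbdd : BoundedMatrices 𝔅)
    {B : ℝ → Matrix (Fin N) (Fin N) ℂ} (hB : ∀ σ, B σ ∈ 𝔅) {T : Finset ℝ} {δ : ℝ}
    (hT : ∀ x ∈ T, ∀ y ∈ T, |x - y| < 2 * δ → x = y) (t₀ : ℝ) :
    ∃ M ∈ LInfty 𝔅, ∀ σ ∈ T, ∀ t, |t - t₀| < δ → M (t - σ) = B σ := by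
  classical
  set M : ℝ → Matrix (Fin N) (Fin N) ℂ := fun s =>
    B 0 + ∑ σ ∈ T, (Set.Ioo (t₀ - σ - δ) (t₀ - σ + δ)).indicator (fun _ => B σ - B 0) s with hM
  have hval : ∀ σ ∈ T, ∀ s, s ∈ Set.Ioo (t₀ - σ - δ) (t₀ - σ + δ) → M s = B σ := by
    intro σ hσ s hs
    simp only [hM]
    rw [Finset.sum_eq_single_of_mem σ hσ, Set.indicator_of_mem hs, add_sub_cancel]
    intro σ' hσ' hne
    refine Set.indicator_of_notMem (fun hs' => hne (hT _ hσ' _ hσ ?_)) _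
    rw [abs_lt]
    constructor <;> linarith [hs.1, hs.2, hs'.1, hs'.2]
  have hmem : ∀ s, M s ∈ 𝔅 := by
    intro s
    by_cases h : ∃ σ ∈ T, s ∈ Set.Ioo (t₀ - σ - δ) (t₀ - σ + δ)
    · obtain ⟨σ, hσ, hs⟩ := h
      rw [hval σ hσ s hs]
      exact hB σ
    · push Not at h
      simp only [hM]
      rw [Finset.sum_eq_zero fun σ hσ => Set.indicator_of_notMem (h σ hσ) _, add_zero]
      exact hB 0
  obtain ⟨C, hC⟩ := hbdd
  refine ⟨M, ⟨fun i j => ?_, Filter.Eventually.of_forall hmem⟩, fun σ hσ t ht => ?_⟩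
  · refine memLp_top_of_bound (C := C) (Measurable.aestronglyMeasurable ?_)
      (Filter.Eventually.of_forall fun s => hC _ (hmem s) i j)
    have : (fun s => M s i j) = fun s => B 0 i j + ∑ σ ∈ T,
        (Set.Ioo (t₀ - σ - δ) (t₀ - σ + δ)).indicator (fun _ => B σ i j - B 0 i j) s := by
      funext s
      simp only [hM, Matrix.add_apply, Matrix.sum_apply]
      congr 1
      refine Finset.sum_congr rfl fun σ _ => ?_
      simp only [Set.indicator_apply]
      split_ifs <;> simp
    rw [this]
    exact measurable_const.add (Finset.measurable_fun_sum _ fun σ _ =>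
      measurable_const.indicator measurableSet_Ioo)
  · refine hval σ hσ _ ?_
    rw [abs_lt] at ht
    constructor <;> linarith [ht.1, ht.2]

section Localization

variable {Λ : Fin N → ℝ} {j : Fin N} {δ : ℝ}

/-- The initial condition `x ↦ oddBump δ (Λ j / 2 - x)` in the `j`-th component. Its components
have zero mean, hence it lies in `Y_p(R)` for every `R`. -/
noncomputable def localizedDatum (Λ : Fin N → ℝ) (j : Fin N) (δ : ℝ) : Fin N → ℝ → ℂ :=
  Pi.single j fun x => oddBump δ (Λ j / 2 - x)

lemma initialTrace_localizedDatum (hδ : δ ≤ Λ j / 2) (j' : Fin N) (t : ℝ) :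
    initialTrace Λ (localizedDatum Λ j δ) j' t = if j' = j then oddBump δ (t + Λ j / 2) else 0 := by
  split_ifs with h
  · subst h
    by_cases ht : t ∈ Set.Ico (-Λ j') 0
    · rw [initialTrace, Set.indicator_of_mem ht, localizedDatum, Pi.single_eq_same]
      congr 1
      ring
    · rw [initialTrace, Set.indicator_of_notMem ht, oddBump_eq_zero]
      rw [Set.mem_Ico, not_and_or, not_le, not_lt] at ht
      rcases ht with ht | ht
      · linarith [neg_abs_le (t + Λ j' / 2)]
      · linarith [le_abs_self (t + Λ j' / 2)]
  · simp [initialTrace, localizedDatum, h]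

lemma eLpNorm_localizedDatum_le {p : ℝ≥0∞} (j' : Fin N) (μ : Measure ℝ)
    (hμ : μ ≤ volume) :
    eLpNorm (localizedDatum Λ j δ j') p μ ≤ ENNReal.ofReal (2 * δ) ^ (1 / p.toReal) := by
  by_cases h : j' = j
  · subst h
    rw [localizedDatum, Pi.single_eq_same]
    have h1 := eLpNorm_comp_measurePreserving (p := p)
      (measurable_oddBump δ).aestronglyMeasurable
      (Measure.measurePreserving_sub_left volume (Λ j' / 2))
    exact (eLpNorm_mono_measure _ hμ).trans (h1.trans_le eLpNorm_oddBump_le)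
  · rw [localizedDatum, Pi.single_eq_of_ne h]
    simp

lemma memY_localizedDatum (hδ : δ ≤ Λ j / 2) (p : ℝ≥0∞) {r : ℕ}
    (R : Matrix (Fin r) (Fin N) ℂ) : MemY Λ p R (localizedDatum Λ j δ) := by
  refine ⟨fun j' => ⟨Measurable.aestronglyMeasurable ?_, ?_⟩, fun k => ?_⟩
  · by_cases h : j' = j
    · subst h
      rw [localizedDatum, Pi.single_eq_same]
      exact (measurable_oddBump δ).comp (measurable_const.sub measurable_id)
    · rw [localizedDatum, Pi.single_eq_of_ne h]
      exact measurable_zero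
  · refine (eLpNorm_localizedDatum_le j' _ Measure.restrict_le_self).trans_lt ?_
    exact ENNReal.rpow_lt_top_of_nonneg (by positivity) ENNReal.ofReal_ne_top
  · refine Finset.sum_eq_zero fun j' _ => ?_
    by_cases h : j' = j
    · subst h
      rw [localizedDatum, Pi.single_eq_same, setIntegral_eq_integral_of_forall_compl_eq_zero,
        integral_sub_left_eq_self (oddBump δ) volume, integral_oddBump, mul_zero]
      intro x hx
      refine oddBump_eq_zero ?_
      rw [Set.mem_Icc, not_and_or, not_le, not_le] at hx
      rcases hx with hx | hx
      · linarith [le_abs_self (Λ j' / 2 - x)]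
      · linarith [neg_abs_le (Λ j' / 2 - x)]
    · rw [localizedDatum, Pi.single_eq_of_ne h]
      simp

end Localization

/-- The initial condition is localized at a point from which the paths with delay `σ` reach the
left end point of the `i`-th component near the time `σ - Λ j / 2`, and paths with other delays do
not interfere. -/
lemma exists_solution_of_totalCoeff {Λ : Fin N → ℝ} (hΛ : ∀ i, 0 < Λ i)
    {𝔅 : Set (Matrix (Fin N) (Fin N) ℂ)} (hbdd : BoundedMatrices 𝔅)
    {B : ℝ → Matrix (Fin N) (Fin N) ℂ} (hB : ∀ σ, B σ ∈ 𝔅) (i j : Fin N) {σ : ℝ}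
    (hσ : ∃ n : Fin N → ℕ, ∑ j, Λ j * (n j : ℝ) = σ) :
    ∃ δ : ℝ, 0 < δ ∧ (∀ i, δ ≤ Λ i / 2) ∧ ∃ M ∈ LInfty 𝔅, ∃ u,
      IsSolution Λ M (localizedDatum Λ j δ) u ∧ ∀ s, |s| < δ →
        trace Λ (localizedDatum Λ j δ) u i (σ - Λ j / 2 + s) =
          totalCoeff Λ B i σ j * oddBump δ s := by
  obtain ⟨m, D, hm0, hD0, hm, hD⟩ := exists_pos_bounds hΛ
  obtain ⟨n, hn⟩ := hσ
  set t₀ := σ - Λ j / 2 with ht₀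
  obtain ⟨K₀, hK₀⟩ := exists_nat_gt ((t₀ + m / 2 + D) / m)
  rw [div_lt_iff₀ hm0] at hK₀
  set K := max K₀ (∑ j, n j) with hK
  have hKm : t₀ + m / 2 + D < K * m := by
    refine hK₀.trans_le ?_
    gcongr
    exact le_max_left _ _
  have hσK : σ ∈ delays Λ K := hn ▸ sum_mul_mem_delays Λ (le_max_right _ _)
  obtain ⟨d, hd0, hd⟩ := exists_separation (delays Λ K)
  set δ := min d (m / 2) with hδ
  have hδ0 : 0 < δ := lt_min hd0 (by positivity)
  have hδm : δ ≤ m / 2 := min_le_right _ _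
  have hδΛ : ∀ i, δ ≤ Λ i / 2 := fun i => by linarith [hm i]
  have hsep : ∀ x ∈ delays Λ K, ∀ y ∈ delays Λ K, |x - y| < 2 * δ → x = y :=
    fun x hx y hy h => hd x hx y hy (h.trans_le (by linarith [min_le_left d (m / 2)]))
  obtain ⟨M, hM, hMB⟩ := exists_signal hbdd hB hsep t₀
  obtain ⟨u, hu⟩ := exists_isSolution hΛ hm0 hm hD M (localizedDatum Λ j δ)
  refine ⟨δ, hδ0, hδΛ, M, hM, u, hu, fun s hs => ?_⟩
  rw [hu.trace_eq_sum_totalCoeff (Λ := Λ) (φ := id) (fun _ => rfl) hm0 hm hD (K := K) (B := B)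
    (by linarith [le_abs_self s])
    (fun σ' hσ' => (hMB σ' hσ' (t₀ + s) (by rwa [add_sub_cancel_left])).symm) i,
    Finset.sum_eq_single_of_mem σ hσK, Finset.sum_eq_single j]
  · rw [initialTrace_localizedDatum (hδΛ j), if_pos rfl, ht₀]
    congr 2
    simp only [id]
    ring
  · intro j' _ hj'
    rw [initialTrace_localizedDatum (hδΛ j), if_neg hj', mul_zero]
  · simp
  · intro σ' hσ' hne
    refine Finset.sum_eq_zero fun j' _ => ?_
    rw [initialTrace_localizedDatum (hδΛ j)]
    split_ifs with h
    · rw [oddBump_eq_zero, mul_zero]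
      by_contra hlt
      refine hne (hsep _ hσ' _ hσK ?_)
      rw [not_le, ht₀, abs_lt] at hlt
      rw [abs_lt] at hs ⊢
      simp only [id] at hlt
      constructor <;> linarith [hlt.1, hlt.2, hs.1, hs.2]
    · rw [mul_zero]

theorem ExponentiallyStable.coeffDecay {Λ : Fin N → ℝ} (hΛ : ∀ i, 0 < Λ i)
    {𝔅 : Set (Matrix (Fin N) (Fin N) ℂ)} (hbdd : BoundedMatrices 𝔅) {p : ℝ≥0∞} (hp : 1 ≤ p)
    {r : ℕ} {R : Matrix (Fin r) (Fin N) ℂ} (hst : ExponentiallyStable Λ (LInfty 𝔅) p R) :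
    CoeffDecay Λ 𝔅 := by
  obtain ⟨γ, hγ, hst⟩ := hst
  obtain ⟨K, hK, hst⟩ := hst (-γ / 2) (by linarith)
  obtain ⟨m, D, hm0, hD0, hm, hD⟩ := exists_pos_bounds hΛ
  set c := -γ / 2 with hc
  have hc0 : 0 < c := by rw [hc]; linarith
  have hγc : γ + c = -c := by rw [hc]; ring
  refine ⟨K * N * Real.exp (c * D) + 1, c, by positivity, hc0, fun B hB i σ j => ?_⟩
  rcases eq_or_ne (totalCoeff Λ B i σ j) 0 with h0 | h0
  · rw [h0, norm_zero]
    positivity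
  rcases eq_or_ne σ 0 with rfl | hσ
  · refine (totalCoeff_zero hΛ B i j).trans ?_
    rw [mul_zero, neg_zero, Real.exp_zero, mul_one]
    have : 0 ≤ K * N * Real.exp (c * D) := by positivity
    linarith
  obtain ⟨hσj, hn⟩ := le_of_totalCoeff_ne_zero hΛ h0 hσ
  obtain ⟨δ, hδ, hδΛ, M, hM, u, hu, hval⟩ :=
    exists_solution_of_totalCoeff hΛ hbdd hB i j hn
  set t₀ := σ - Λ j / 2 with ht₀
  have ht0 : 0 ≤ t₀ + δ := by rw [ht₀]; linarith [hΛ j]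
  set θ := totalCoeff Λ B i σ j with hθ
  set q := ENNReal.ofReal (2 * δ) ^ (1 / p.toReal) with hq
  have hq0 : q ≠ 0 := (ENNReal.rpow_pos (by simpa using hδ) ENNReal.ofReal_ne_top).ne'
  have hqtop : q ≠ ∞ := (ENNReal.rpow_lt_top_of_nonneg (by positivity) ENNReal.ofReal_ne_top).ne
  -- At the time `t₀ + δ`, the bump emitted from the left end point occupies `(0, 2 * δ)`.
  have hlow : ‖θ‖ₑ * q ≤ normX Λ p (fun i => u i (t₀ + δ)) := by
    refine le_trans ?_ (eLpNorm_le_normX hp _ i)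
    have hsub : Set.Ioo 0 (2 * δ) ⊆ Set.Icc 0 (Λ i) := fun x hx =>
      ⟨hx.1.le, by linarith [hx.2, hδΛ i]⟩
    refine le_trans ?_ (eLpNorm_mono_measure _ (Measure.restrict_mono hsub le_rfl))
    have h1 : eLpNorm (fun _ => θ) p (volume.restrict (Set.Ioo 0 (2 * δ))) = ‖θ‖ₑ * q := by
      rw [eLpNorm_const _ (zero_lt_one.trans_le hp).ne', Measure.restrict_apply_univ,
        Real.volume_Ioo, sub_zero]
      intro h
      have := congrArg (fun μ => μ Set.univ) h
      simp [hδ.not_ge] at this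
    rw [← h1]
    refine eLpNorm_mono_ae ?_
    have hδx : ∀ᵐ x ∂(volume : Measure ℝ), x ≠ δ := by simp [ae_iff]
    filter_upwards [ae_restrict_mem measurableSet_Ioo, ae_restrict_of_ae hδx] with x hx hxδ
    have hx' : |δ - x| < δ := by
      rw [abs_lt]
      constructor <;> linarith [hx.1, hx.2]
    rw [hu.eq_trace ht0 (hsub hx), add_sub_assoc, hval _ hx', norm_mul,
      norm_oddBump hx' (sub_ne_zero.2 hxδ.symm), mul_one]
  have hup : normX Λ p (localizedDatum Λ j δ) ≤ N * q :=
    normX_le hp fun j' => eLpNorm_localizedDatum_le j' _ Measure.restrict_le_self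
  have hmain : ‖θ‖ₑ * q ≤ ENNReal.ofReal (K * Real.exp ((γ + c) * (t₀ + δ)) * N) * q := by
    refine hlow.trans ((hst M hM _ u (memY_localizedDatum (hδΛ j) p R) hu _ ht0).trans ?_)
    rw [ENNReal.ofReal_mul (q := (N : ℝ)) (by positivity), ENNReal.ofReal_natCast, mul_assoc]
    gcongr
  rw [ENNReal.mul_le_mul_iff_left hq0 hqtop, ← ofReal_norm,
    ENNReal.ofReal_le_ofReal_iff (by positivity)] at hmain
  calc ‖θ‖ ≤ K * Real.exp ((γ + c) * (t₀ + δ)) * N := hmain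
    _ ≤ K * Real.exp (c * D + -(c * σ)) * N := by
        gcongr
        rw [hγc, ht₀]
        nlinarith [hD j, hΛ j]
    _ = K * N * Real.exp (c * D) * Real.exp (-(c * σ)) := by rw [Real.exp_add]; ring
    _ ≤ _ := by
        gcongr
        linarith

/-- The whole space `X_p`, which is `Y_p(R)` for the matrix `R` without rows, is invariant. -/
lemma inv_of_no_rows {L : Fin N → ℝ} (hL : ∀ i, 0 < L i)
    (𝔅 : Set (Matrix (Fin N) (Fin N) ℂ)) (R : Matrix (Fin 0) (Fin N) ℂ) :
    Inv L (LInfty 𝔅) R := by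
  obtain ⟨m, D, hm0, -, hm, hD⟩ := exists_pos_bounds hL
  exact fun M hM p _ u₀ u hu₀ hu t ht =>
    ⟨hu.memX hm0 hm hD hM.1 hu₀.1 ht, fun k => k.elim0⟩

end TransportSystem

theorem mainTheorem3 (N : ℕ) (hN : 0 < N) (Λ : Fin N → ℝ) (hΛ : ∀ i, 0 < Λ i)
    (𝔅 : Set (Matrix (Fin N) (Fin N) ℂ)) (h𝔅_nonempty : 𝔅.Nonempty)
    (h𝔅_bounded : TransportSystem.BoundedMatrices 𝔅) :
    (∃ p : ENNReal, 1 ≤ p ∧ ∃ (r : ℕ) (R : Matrix (Fin r) (Fin N) ℂ),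
        TransportSystem.Inv Λ (TransportSystem.LInfty 𝔅) R ∧
        TransportSystem.ExponentiallyStable Λ (TransportSystem.LInfty 𝔅) p R) ↔
    (∀ L ∈ TransportSystem.VPlus Λ, ∀ p : ENNReal, 1 ≤ p →
      ∀ (r : ℕ) (R : Matrix (Fin r) (Fin N) ℂ),
        TransportSystem.Inv L (TransportSystem.LInfty 𝔅) R →
        TransportSystem.ExponentiallyStable L (TransportSystem.LInfty 𝔅) p R) := by
  constructor
  · rintro ⟨p, hp, r, R, -, hst⟩ L hL p' hp' r' R' -
    exact (hst.coeffDecay hΛ h𝔅_bounded hp).exponentiallyStable hΛ h𝔅_nonempty hL hp' R'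
  · intro h
    have hinv := TransportSystem.inv_of_no_rows hΛ 𝔅 0
    exact ⟨1, le_rfl, 0, 0, hinv, h Λ ⟨hΛ, fun _ hn => hn⟩ 1 le_rfl 0 0 hinv⟩
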